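/- Algebras are not assumed to have an identity element. Let $F$ be an algebraically closed field of characteristic $0$, let $A$ be a finite dimensional associative algebra over $F$, and let $\mathfrak g$ be a finite dimensional semisimple Lie algebra over $F$. Suppose that $A$ is a $\mathfrak g$-module on which $\mathfrak g$ acts by derivations, i.e. $\delta(ab)=(\delta a)b+a(\delta b)$ for all $\delta\in\mathfrak g$ and $a,b\in A$. Denote by $J(A)$ the Jacobson radical of $A$; a finite dimensional associative algebra is called semisimple if its Jacobson radical is zero (so the zero algebra is semisimple). Then there exists a subalgebra $B\subseteq A$ that is maximal, with respect to inclusion, among the semisimple subalgebras of $A$, such that $B$ and $J(A)$ are $\mathfrak g$-submodules of $A$ and $A=B\oplus J(A)$ (direct sum of $\mathfrak g$-submodules). -/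

import Mathlib

/-!
Associative algebras are not assumed to have an identity element: an associative algebra over a
field `F` is a `NonUnitalRing A` with `[Module F A] [IsScalarTower F A A] [SMulCommClass F A A]`.
-/

namespace AssocAlg

section

variable (F : Type*) {A : Type*} [Field F] [NonUnitalRing A] [Module F A]
  [IsScalarTower F A A] [SMulCommClass F A A]

/-- The description of the Jacobson radical by quasi-regularity agrees with the Jacobson radical of
the algebra with an identity element adjoined. -/
theorem forall_isQuasiregular_mul_iff (a : A) :
    (∀ x : A, IsQuasiregular (x * a)) ↔ (a : Unitization F A) ∈ Ring.jacobson (Unitization F A) := by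
  rw [← Ideal.jacobson_bot]
  constructor
  · intro h
    rw [Ideal.mem_jacobson_iff]
    intro y
    have e1 : y * (a : Unitization F A) = ((y * (a : Unitization F A)).snd : A) := by
      ext <;> simp
    set b : A := (y * (a : Unitization F A)).snd with hb
    have e2 : (b : Unitization F A) * y = (((b : Unitization F A) * y).snd : A) := by
      ext <;> simp
    set c : A := ((b : Unitization F A) * y).snd with hc
    have h1 : IsUnit (1 + ((-c * a : A) : Unitization F A)) :=
      (isQuasiregular_iff_isUnit' F).1 (h (-c))
    obtain ⟨w, hw⟩ := h1.exists_left_inv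
    refine ⟨w * (1 - (b : Unitization F A)), ?_⟩
    have e3 : (b : Unitization F A) * b = (c : Unitization F A) * a := by
      rw [← e2, mul_assoc, e1]
    have e4 : (1 - (b : Unitization F A)) * (1 + b) = 1 + ((-c * a : A) : Unitization F A) := by
      have : ((-c * a : A) : Unitization F A) = -((c : Unitization F A) * a) := by
        rw [neg_mul, Unitization.inr_neg, Unitization.inr_mul]
      rw [this, ← e3]
      noncomm_ring
    have e5 : w * (1 - (b : Unitization F A)) * (1 + b) = 1 := by
      rw [mul_assoc, e4, hw]
    rw [Submodule.mem_bot, mul_assoc _ y, e1]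
    rw [mul_add, mul_one] at e5
    rw [add_comm, e5, sub_self]
  · intro h x
    have key : ∀ j ∈ Ideal.jacobson (⊥ : Ideal (Unitization F A)), ∃ s, s * (1 + j) = 1 := by
      intro j hj
      obtain ⟨s, hs⟩ := Ideal.mem_jacobson_iff.1 hj 1
      rw [Submodule.mem_bot, mul_one, sub_eq_zero] at hs
      exact ⟨s, by rw [mul_add, mul_one, add_comm, hs]⟩
    rw [isQuasiregular_iff_isUnit' F, Unitization.inr_mul]
    have hj := Ideal.mul_mem_left _ (x : Unitization F A) h
    set j : Unitization F A := (x : Unitization F A) * a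
    obtain ⟨s, hs⟩ := key j hj
    obtain ⟨t, ht⟩ := key (-s * j) (Ideal.mul_mem_left _ _ hj)
    have hs' : 1 + -s * j = s := by
      rw [mul_add, mul_one] at hs
      rw [← hs]
      noncomm_ring
    rw [hs'] at ht
    have : t = 1 + j := left_inv_eq_right_inv ht hs
    rw [← this] at hs ⊢
    exact ⟨⟨t, s, ht, hs⟩, rfl⟩

variable (A)

/-- The Jacobson radical `J(A)` of an associative `F`-algebra `A`, with or without an identity
element: the set of all `a` such that every element of the left ideal `A * a` is quasi-regular. -/
def jacobsonRadical : Submodule F A where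
  carrier := {a | ∀ x : A, IsQuasiregular (x * a)}
  zero_mem' := fun x => by rw [mul_zero]; exact isQuasiregular_iff.2 ⟨0, by simp, by simp⟩
  add_mem' := by
    intro a b ha hb
    have ha' := (forall_isQuasiregular_mul_iff F a).1 ha
    have hb' := (forall_isQuasiregular_mul_iff F b).1 hb
    refine (forall_isQuasiregular_mul_iff F (a + b)).2 ?_
    rw [Unitization.inr_add]
    exact add_mem ha' hb'
  smul_mem' := fun c a ha x => by
    have h := ha (c • x)
    rwa [smul_mul_assoc, ← mul_smul_comm] at h

/-- An associative algebra is semisimple if its Jacobson radical is zero. (The algebras to which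
this is applied are finite dimensional.) -/
def IsSemisimpleAlg : Prop := jacobsonRadical F A = ⊥

end

section

variable {F g A : Type*} [Field F] [LieRing g] [LieAlgebra F g] [NonUnitalRing A] [Module F A]
  [LieRingModule g A]

variable (g A) in
/-- The action of the Lie algebra `g` on the algebra `A` is by derivations. -/
def ActsByDerivations : Prop :=
  ∀ (x : g) (a b : A), ⁅x, a * b⁆ = ⁅x, a⁆ * b + a * ⁅x, b⁆

end

end AssocAlg

/-! Adjoin an identity: `U = F ⊕ A`, on which `g` acts by derivations killing `1`. The radical of
`U` is nilpotent and lies in `A`, where it equals `J(A)`, so everything can be done in `U`; write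
`J` for it.

In characteristic zero `J` is the radical of the form `tr L_{xy}`. Derivations have trace-zero
effect on this form, so `J` is `g`-stable. Weyl's theorem, obtained from Whitehead's first lemma by
Casimir operators, gives an equivariant projection onto `J(A)`, hence an equivariant linear section
`s` of `U → U/J`.

It remains to make `s` multiplicative without losing equivariance. The trace form of the semisimple
algebra `U/J` yields a separability idempotent annihilated by every derivation. Subtracting from `s`
the contraction of its defect `s a * s b - s (a * b)` with this idempotent moves the defect from
`J^k` into `J * J^k`, and the correction is equivariant. As `J` is nilpotent, the process ends
(`exists_multiplicative_section`); intersecting the image with `A` gives `B`.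

Maximality is formal: if `C ⊇ B` is semisimple, then `C ∩ J(A)` lies in `J(C) = 0`. -/

open scoped TensorProduct

/-! ### Casimir tensors, used below for both Lie and associative trace forms -/

/-- The Casimir tensor of a nondegenerate bilinear form intertwines an operator and its adjoint. -/
theorem LinearMap.BilinForm.exists_casimirTensor {F V : Type*} [Field F] [AddCommGroup V]
    [Module F V] [Module.Finite F V] (B : LinearMap.BilinForm F V) (hB : B.Nondegenerate) :
    ∃ e : V ⊗[F] V,
      (∀ T T' : V →ₗ[F] V, (∀ x y, B (T x) y = B x (T' y)) → T.rTensor V e = T'.lTensor V e) ∧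
      ∀ T : V →ₗ[F] V, TensorProduct.lift (B.compl₂ T) e = LinearMap.trace F V T := by
  classical
  let b := Module.finBasis F V
  let d := B.dualBasis hB b
  have hbd (i j) : B (d i) (b j) = if j = i then 1 else 0 := B.apply_dualBasis_left hB b i j
  have exd (x : V) : x = ∑ j, B x (b j) • d j := by
    conv_lhs => rw [← d.sum_repr x]
    simp only [d, LinearMap.BilinForm.dualBasis_repr_apply]
  have hrepr (x : V) (i) : b.repr x i = B (d i) x := by
    conv_rhs => rw [← b.sum_repr x]
    simp only [map_sum, map_smul, hbd, smul_eq_mul, mul_ite, mul_one, mul_zero,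
      Finset.sum_ite_eq', Finset.mem_univ, if_true]
  have exb (x : V) : x = ∑ j, B (d j) x • b j := by
    conv_lhs => rw [← b.sum_repr x]
    simp only [hrepr]
  -- Applying `T` on the left or `T'` on the right gives the same double sum, with coefficients `B
  -- (d i) (T' (b j))`.
  refine ⟨∑ i, d i ⊗ₜ b i, fun T T' h => ?_, fun T => ?_⟩
  · simp only [map_sum, LinearMap.rTensor_tmul, LinearMap.lTensor_tmul]
    have h1 (i) : T (d i) ⊗ₜ[F] b i = ∑ j, B (d i) (T' (b j)) • (d j ⊗ₜ[F] b i) := by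
      conv_lhs => rw [exd (T (d i))]
      simp only [TensorProduct.sum_tmul, TensorProduct.smul_tmul', h]
    have h2 (j) : d j ⊗ₜ[F] T' (b j) = ∑ i, B (d i) (T' (b j)) • (d j ⊗ₜ[F] b i) := by
      conv_lhs => rw [exb (T' (b j))]
      simp only [TensorProduct.tmul_sum, TensorProduct.tmul_smul]
    simp only [h1, h2]
    exact Finset.sum_comm
  · rw [LinearMap.trace_eq_matrix_trace F b, Matrix.trace, map_sum]
    refine Finset.sum_congr rfl fun i _ => ?_
    simp [LinearMap.toMatrix_apply, hrepr]

theorem TensorProduct.lift_mem {R M N P : Type*} [CommSemiring R] [AddCommMonoid M]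
    [AddCommMonoid N] [AddCommMonoid P] [Module R M] [Module R N] [Module R P]
    (Φ : M →ₗ[R] N →ₗ[R] P) {S : Type*} [SetLike S P] [AddSubmonoidClass S P] (I : S)
    (h : ∀ x y, Φ x y ∈ I) (e : M ⊗[R] N) : TensorProduct.lift Φ e ∈ I := by
  induction e with
  | zero => rw [map_zero]; exact zero_mem I
  | tmul x y => exact h x y
  | add x y hx hy => rw [map_add]; exact add_mem hx hy

/-! ### Whitehead's first lemma and Weyl's complete reducibility -/

namespace LieAlgebra

variable {F g : Type*} [Field F] [LieRing g] [LieAlgebra F g] [Module.Finite F g]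

/-- By invariance, anything Killing-orthogonal to `[g, g]` is central, hence zero. -/
theorem lie_top_eq_top_of_isKilling [IsKilling F g] :
    ⁅(⊤ : LieIdeal F g), (⊤ : LieIdeal F g)⁆ = ⊤ := by
  set D : LieIdeal F g := ⁅(⊤ : LieIdeal F g), (⊤ : LieIdeal F g)⁆ with hD
  have h : LieIdeal.killingCompl F g D = ⊥ := by
    rw [eq_bot_iff]
    intro x hx
    rw [LieIdeal.mem_killingCompl] at hx
    have hc : x ∈ LieAlgebra.center F g := by
      rw [LieModule.mem_maxTrivSubmodule]
      intro y
      apply (IsKilling.killingForm_nondegenerate F g).1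
      intro z
      rw [LieModule.traceForm_apply_lie_apply', LieModule.traceForm_comm, neg_eq_zero]
      exact hx _ (LieSubmodule.lie_mem_lie (LieSubmodule.mem_top _) (LieSubmodule.mem_top _))
    rwa [LieAlgebra.center_eq_bot] at hc
  have hc := (LieIdeal.isCompl_killingCompl D).sup_eq_top
  rwa [h, sup_bot_eq] at hc

theorem linearMap_eq_zero_of_forall_lie [IsKilling F g] {V : Type*} [AddCommGroup V] [Module F V]
    (f : g →ₗ[F] V) (h : ∀ x y : g, f ⁅x, y⁆ = 0) : f = 0 := by
  have h1 : (⊤ : LieIdeal F g).toSubmodule ≤ LinearMap.ker f := by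
    rw [← lie_top_eq_top_of_isKilling, LieSubmodule.lieIdeal_oper_eq_linear_span, Submodule.span_le]
    rintro _ ⟨x, y, rfl⟩
    exact h _ _
  ext x
  exact h1 (LieSubmodule.mem_top x)

/-- A vanishing trace form makes the perfect algebra `g` act nilpotently. If `gV` lies in one term
of the lower central series, then `[y, z]v = y(zv) - z(yv)` lies in the next, and perfectness puts
all of `gV` there; the series reaches zero. -/
theorem lie_eq_zero_of_traceForm_eq_zero [CharZero F] [IsKilling F g] {V : Type*} [AddCommGroup V]
    [Module F V] [Module.Finite F V] [LieRingModule g V] [LieModule F g V]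
    (h : LieModule.traceForm F g V = 0) (x : g) (v : V) : ⁅x, v⁆ = 0 := by
  have h1 := LieModule.isNilpotent_derivedSeries_of_traceForm_eq_zero h
  rw [LieModule.isNilpotent_iff_forall' (R := F)] at h1
  have hD : derivedSeries F g 1 = ⊤ := by
    rw [derivedSeries_def, derivedSeriesOfIdeal_succ, derivedSeriesOfIdeal_zero,
      lie_top_eq_top_of_isKilling]
  have h2 : LieModule.IsNilpotent g V := by
    rw [LieModule.isNilpotent_iff_forall' (R := F)]
    intro x
    exact h1 ⟨x, hD ▸ LieSubmodule.mem_top x⟩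
  obtain ⟨k, hk⟩ := (LieModule.isNilpotent_iff F g V).1 h2
  have key (n : ℕ) (x : g) (v : V) : ⁅x, v⁆ ∈ LieModule.lowerCentralSeries F g V n := by
    induction n generalizing x v with
    | zero => simp
    | succ n ih =>
      let f : g →ₗ[F] V ⧸ (LieModule.lowerCentralSeries F g V (n + 1)).toSubmodule :=
        (Submodule.mkQ _).comp ((LieModule.toEnd F g V : g →ₗ[F] Module.End F V).flip v)
      have hf : f = 0 := by
        refine linearMap_eq_zero_of_forall_lie f fun y z => ?_
        have : ⁅⁅y, z⁆, v⁆ ∈ LieModule.lowerCentralSeries F g V (n + 1) := by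
          rw [lie_lie, LieModule.lowerCentralSeries_succ]
          exact sub_mem (LieSubmodule.lie_mem_lie (LieSubmodule.mem_top _) (ih _ _))
            (LieSubmodule.lie_mem_lie (LieSubmodule.mem_top _) (ih _ _))
        exact (Submodule.Quotient.mk_eq_zero _).2 this
      exact (Submodule.Quotient.mk_eq_zero _).1 (LinearMap.congr_fun hf x)
  have := key k x v
  rwa [hk, LieSubmodule.mem_bot] at this

section

variable (F g : Type*) [Field F] [LieRing g] [LieAlgebra F g]

/-- The radical of the trace form of a Lie module, as an ideal. -/
noncomputable def traceFormRadical (V : Type*) [AddCommGroup V] [Module F V] [LieRingModule g V]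
    [LieModule F g V] : LieIdeal F g where
  __ := LinearMap.ker (LieModule.traceForm F g V)
  lie_mem {x y} hy := by
    change LieModule.traceForm F g V y = 0 at hy
    change LieModule.traceForm F g V ⁅x, y⁆ = 0
    ext z
    rw [LieModule.traceForm_apply_lie_apply', hy]
    simp

variable {F g} in
theorem mem_traceFormRadical {V : Type*} [AddCommGroup V] [Module F V] [LieRingModule g V]
    [LieModule F g V] {x : g} :
    x ∈ traceFormRadical F g V ↔ LieModule.traceForm F g V x = 0 := Iff.rfl

end

variable {F g : Type*} [Field F] [LieRing g] [LieAlgebra F g] [Module.Finite F g]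

/-- A Casimir operator of a module with nonzero trace form. -/
theorem exists_casimirOperator [CharZero F] [IsKilling F g] (V : Type*) [AddCommGroup V]
    [Module F V] [Module.Finite F V] [LieRingModule g V] [LieModule F g V]
    (h : LieModule.traceForm F g V ≠ 0) :
    ∃ C : Module.End F V, ¬ IsNilpotent C ∧ (∀ (x : g) (v : V), C ⁅x, v⁆ = ⁅x, C v⁆) ∧
      ∀ c : g →ₗ[F] V, (∀ x y : g, c ⁅x, y⁆ = ⁅x, c y⁆ - ⁅y, c x⁆) →
        ∃ w : V, ∀ x, C (c x) = ⁅x, w⁆ := by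
  -- The trace form may be degenerate on `g`; it is nondegenerate on the Killing complement of its
  -- radical, where the Casimir tensor is taken.
  set I := traceFormRadical F g V with hI
  set K := LieIdeal.killingCompl F g I with hK
  have hc : IsCompl I K := LieIdeal.isCompl_killingCompl I
  let B : LinearMap.BilinForm F K :=
    (LieModule.traceForm F g V).compl₁₂ K.toSubmodule.subtype K.toSubmodule.subtype
  have hBa (x y : K) : B x y = LieModule.traceForm F g V x y := rfl
  have hleft : ∀ x : K, (∀ y, B x y = 0) → x = 0 := by
    intro x hx
    have hxI : (x : g) ∈ I := by
      rw [mem_traceFormRadical]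
      ext z
      have hz : z ∈ I ⊔ K := by rw [hc.sup_eq_top]; exact LieSubmodule.mem_top z
      obtain ⟨a, ha, b, hb, rfl⟩ := (LieSubmodule.mem_sup _ _ _).1 hz
      rw [map_add, ← hBa x ⟨b, hb⟩, hx, LieModule.traceForm_comm, mem_traceFormRadical.1 ha]
      simp
    have hb : (x : g) ∈ I ⊓ K := ⟨hxI, x.2⟩
    rw [hc.inf_eq_bot, LieSubmodule.mem_bot] at hb
    exact Subtype.ext hb
  have hB : B.Nondegenerate := by
    refine ⟨fun x hx => hleft x hx, fun x hx => hleft x fun y => ?_⟩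
    rw [hBa, LieModule.traceForm_comm]
    exact hx y
  obtain ⟨e, he, htr⟩ := B.exists_casimirTensor hB
  let φ : K →ₗ[F] Module.End F V :=
    (LieModule.toEnd F g V : g →ₗ[F] Module.End F V).comp K.toSubmodule.subtype
  have hφ (a : K) (v : V) : φ a v = ⁅(a : g), v⁆ := rfl
  let T (x : g) : K →ₗ[F] K := LieModule.toEnd F g K x
  have hT (x : g) (a : K) : ((T x a : K) : g) = ⁅x, (a : g)⁆ := rfl
  -- Invariance of the form says that `ad x` is skew, so the Casimir tensor is `g`-invariant.
  have hTe (x : g) : (T x).rTensor K e + (T x).lTensor K e = 0 := by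
    rw [he (T x) (-T x) fun a b => ?_, LinearMap.lTensor_neg, LinearMap.neg_apply, neg_add_cancel]
    rw [LinearMap.neg_apply, map_neg, hBa, hBa, hT, hT, LieModule.traceForm_apply_lie_apply']
  let C : Module.End F V := TensorProduct.lift ((LinearMap.mul F (Module.End F V)).compl₁₂ φ φ) e
  refine ⟨C, fun hC => ?_, fun x v => ?_, fun c hcc => ?_⟩
  -- The trace of `C` is `dim K`, nonzero in characteristic zero unless `K = 0`, in which case the
  -- trace form vanishes.
  · have h1 := (LinearMap.isNilpotent_trace_of_isNilpotent hC).eq_zero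
    have h2 : LinearMap.trace F V C = LinearMap.trace F K LinearMap.id := by
      rw [← htr]
      change ((LinearMap.trace F V).comp (TensorProduct.lift _)) e = _
      congr 1
      refine TensorProduct.ext' fun a b => ?_
      rfl
    rw [h2, LinearMap.trace_id, Nat.cast_eq_zero, Module.finrank_eq_zero_iff_of_free] at h1
    apply h
    have hK0 : K = ⊥ := by
      rw [LieSubmodule.eq_bot_iff]
      intro x hx
      exact congrArg Subtype.val (Subsingleton.elim (⟨x, hx⟩ : K) 0)
    have hI1 := hc.sup_eq_top
    rw [hK0, sup_bot_eq] at hI1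
    refine LinearMap.ext fun x => ?_
    exact mem_traceFormRadical.1 (show x ∈ I from hI1 ▸ LieSubmodule.mem_top x)
  · let Φ := (LinearMap.mul F (Module.End F V)).compl₁₂ φ φ
    have key : ∀ e : K ⊗[F] K, ⁅x, TensorProduct.lift Φ e v⁆ - TensorProduct.lift Φ e ⁅x, v⁆ =
        TensorProduct.lift Φ ((T x).rTensor K e + (T x).lTensor K e) v := by
      intro e
      induction e with
      | zero => simp
      | add a b ha hb =>
        simp only [map_add, LinearMap.add_apply, lie_add] at ha hb ⊢
        rw [add_sub_add_comm, ha, hb]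
        abel
      | tmul a b =>
        simp only [map_add, LinearMap.rTensor_tmul, LinearMap.lTensor_tmul, LinearMap.add_apply,
          TensorProduct.lift.tmul, Φ, LinearMap.compl₁₂_apply, LinearMap.mul_apply',
          Module.End.mul_apply, hφ, hT, lie_lie, lie_sub]
        abel
    have := key e
    rw [hTe, map_zero, LinearMap.zero_apply, sub_eq_zero] at this
    exact this.symm
  · let Ψ : K →ₗ[F] K →ₗ[F] V := φ.compl₂ (c.comp K.toSubmodule.subtype)
    let Φ := (LinearMap.mul F (Module.End F V)).compl₁₂ φ φ
    have hΨ (a b : K) : Ψ a b = ⁅(a : g), c b⁆ := rfl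
    refine ⟨TensorProduct.lift Ψ e, fun x => ?_⟩
    have key : ∀ e : K ⊗[F] K, ⁅x, TensorProduct.lift Ψ e⁆ - TensorProduct.lift Φ e (c x) =
        TensorProduct.lift Ψ ((T x).rTensor K e + (T x).lTensor K e) := by
      intro e
      induction e with
      | zero => simp
      | add a b ha hb =>
        simp only [map_add, LinearMap.add_apply, lie_add] at ha hb ⊢
        rw [add_sub_add_comm, ha, hb]
        abel
      | tmul a b =>
        simp only [map_add, LinearMap.rTensor_tmul, LinearMap.lTensor_tmul,
          TensorProduct.lift.tmul, Φ, LinearMap.compl₁₂_apply, LinearMap.mul_apply',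
          Module.End.mul_apply, hΨ, hφ, hT, hcc, lie_lie, lie_sub]
        abel
    have := key e
    rw [hTe, map_zero, sub_eq_zero] at this
    exact this.symm

/-- **Whitehead's first lemma**: every `1`-cocycle is a coboundary. -/
theorem exists_eq_lie_of_isKilling [CharZero F] [IsKilling F g] (V : Type*) [AddCommGroup V]
    [Module F V] [Module.Finite F V] [LieRingModule g V] [LieModule F g V]
    (c : g →ₗ[F] V) (hc : ∀ x y : g, c ⁅x, y⁆ = ⁅x, c y⁆ - ⁅y, c x⁆) :
    ∃ v : V, ∀ x, c x = ⁅x, v⁆ := by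
  by_cases h : LieModule.traceForm F g V = 0
  · refine ⟨0, fun x => ?_⟩
    rw [lie_zero, linearMap_eq_zero_of_forall_lie c, LinearMap.zero_apply]
    intro x y
    rw [hc, lie_eq_zero_of_traceForm_eq_zero h, lie_eq_zero_of_traceForm_eq_zero h, sub_zero]
  obtain ⟨C, hC, hCg, hCc⟩ := exists_casimirOperator V h
  obtain ⟨w, hw⟩ := hCc c hc
  have hpow (n : ℕ) (x : g) (v : V) : (C ^ n) ⁅x, v⁆ = ⁅x, (C ^ n) v⁆ := by
    induction n with
    | zero => simp
    | succ n ih => rw [pow_succ', Module.End.mul_apply, ih, hCg, Module.End.mul_apply]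
  -- Fitting's argument: once the ranges of powers of `C` stabilise, `C ^ n w = C ^ (n + 1) v`.
  -- Subtracting the coboundary of `v` moves the cocycle into the kernel of `C ^ (n + 1)`, a proper
  -- submodule since `C` is not nilpotent, and induction on dimension applies.
  obtain ⟨n, hn⟩ := Filter.eventually_atTop.1 (LinearMap.eventually_iInf_range_pow_eq C)
  have hmem : (C ^ n) w ∈ LinearMap.range (C ^ (n + 1)) := by
    rw [← hn (n + 1) n.le_succ, hn n le_rfl]
    exact LinearMap.mem_range_self _ _
  obtain ⟨v, hv⟩ := hmem
  let N : LieSubmodule F g V :=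
    { LinearMap.ker (C ^ (n + 1)) with
      lie_mem := fun {x y} hy => by
        change (C ^ (n + 1)) y = 0 at hy
        change (C ^ (n + 1)) ⁅x, y⁆ = 0
        rw [hpow, hy, lie_zero] }
  have hcN (x : g) : c x - ⁅x, v⁆ ∈ N := by
    change (C ^ (n + 1)) (c x - ⁅x, v⁆) = 0
    rw [map_sub, hpow, hv, pow_succ, Module.End.mul_apply, hw, hpow, sub_self]
  have hlt : Module.finrank F N < Module.finrank F V := by
    refine Submodule.finrank_lt fun hN => hC ⟨n + 1, ?_⟩
    exact LinearMap.ker_eq_top.1 hN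
  let c' : g →ₗ[F] N :=
    LinearMap.codRestrict N.toSubmodule
      (c - (LieModule.toEnd F g V : g →ₗ[F] Module.End F V).flip v) hcN
  have hc' (x : g) : (c' x : V) = c x - ⁅x, v⁆ := rfl
  obtain ⟨u, hu⟩ := exists_eq_lie_of_isKilling N c' fun x y => by
    apply Subtype.ext
    simp only [LieSubmodule.coe_sub, LieSubmodule.coe_bracket, hc', hc, lie_lie, lie_sub]
    abel
  refine ⟨v + u, fun x => ?_⟩
  have := congrArg Subtype.val (hu x)
  rw [hc', LieSubmodule.coe_bracket, sub_eq_iff_eq_add'] at this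
  rw [this, lie_add]
termination_by Module.finrank F V

/-- **Weyl's theorem**: every submodule is the image of an equivariant projection. -/
theorem exists_equivariant_projection [CharZero F] [IsKilling F g] {M : Type*} [AddCommGroup M]
    [Module F M] [Module.Finite F M] [LieRingModule g M] [LieModule F g M]
    (N : LieSubmodule F g M) :
    ∃ p : M →ₗ[F] M, (∀ (x : g) (m : M), p ⁅x, m⁆ = ⁅x, p m⁆) ∧ (∀ m, p m ∈ N) ∧
      ∀ m ∈ N, p m = m := by
  obtain ⟨q, hq⟩ := N.toSubmodule.exists_isCompl
  let p₀ : M →ₗ[F] M := N.toSubmodule.projection q hq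
  have hp₀N (m : M) : p₀ m ∈ N := Submodule.projection_apply_mem hq m
  have hp₀ (m : M) (hm : m ∈ N) : p₀ m = m :=
    Submodule.projection_apply_of_mem_left hq hm
  -- Two projections onto `N` differ by an element of `V`, so `x ↦ ⁅x, p₀⁆` is a cocycle in `V`;
  -- writing it as the coboundary of `v` makes `p₀ - v` equivariant.
  let V : LieSubmodule F g (M →ₗ[F] M) :=
    { carrier := {f | (∀ m, f m ∈ N) ∧ ∀ m ∈ N, f m = 0}
      zero_mem' := ⟨fun m => N.zero_mem, fun m _ => rfl⟩
      add_mem' := fun {a b} ha hb => ⟨fun m => N.add_mem (ha.1 m) (hb.1 m), fun m hm => by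
        rw [LinearMap.add_apply, ha.2 m hm, hb.2 m hm, add_zero]⟩
      smul_mem' := fun r f hf => ⟨fun m => N.smul_mem r (hf.1 m), fun m hm => by
        rw [LinearMap.smul_apply, hf.2 m hm, smul_zero]⟩
      lie_mem := fun {x f} hf => ⟨fun m => by
          rw [LieHom.lie_apply]
          exact sub_mem (N.lie_mem (hf.1 m)) (hf.1 _), fun m hm => by
          rw [LieHom.lie_apply, hf.2 m hm, hf.2 _ (N.lie_mem hm), lie_zero, sub_zero]⟩ }
  have hV (x : g) : ⁅x, p₀⁆ ∈ V := by
    refine ⟨fun m => ?_, fun m hm => ?_⟩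
    · rw [LieHom.lie_apply]
      exact sub_mem (N.lie_mem (hp₀N m)) (hp₀N _)
    · rw [LieHom.lie_apply, hp₀ m hm, hp₀ _ (N.lie_mem hm), sub_self]
  let c : g →ₗ[F] V := LinearMap.codRestrict V.toSubmodule
    ((LieModule.toEnd F g (M →ₗ[F] M) : g →ₗ[F] Module.End F (M →ₗ[F] M)).flip p₀) hV
  have hc (x : g) : (c x : M →ₗ[F] M) = ⁅x, p₀⁆ := rfl
  obtain ⟨v, hv⟩ := exists_eq_lie_of_isKilling V c fun x y => by
    apply Subtype.ext
    simp only [LieSubmodule.coe_sub, LieSubmodule.coe_bracket, hc, lie_lie]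
  refine ⟨p₀ - v, fun x m => ?_, fun m => sub_mem (hp₀N m) (v.2.1 m), fun m hm => ?_⟩
  · have h1 := LinearMap.congr_fun (congrArg Subtype.val (hv x)) m
    rw [hc, LieSubmodule.coe_bracket, LieHom.lie_apply, LieHom.lie_apply] at h1
    rw [LinearMap.sub_apply, LinearMap.sub_apply, lie_sub]
    rw [sub_eq_sub_iff_add_eq_add] at h1 ⊢
    rw [add_comm, ← h1, add_comm]
  · rw [LinearMap.sub_apply, hp₀ m hm, v.2.2 m hm, sub_zero]

end LieAlgebra

/-! ### Trace forms and the Jacobson radical of a unital algebra -/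

namespace FiniteDimensionalAlgebra

variable {F U : Type*} [Field F] [Ring U] [Algebra F U]

theorem mem_jacobson_of_forall_isNilpotent {a : U} (h : ∀ x : U, IsNilpotent (x * a)) :
    a ∈ Ring.jacobson U := by
  rw [← Ideal.jacobson_bot, Ideal.mem_jacobson_iff]
  intro y
  obtain ⟨z, hz⟩ := (h y).isUnit_one_add.exists_left_inv
  refine ⟨z, ?_⟩
  rw [Submodule.mem_bot, ← hz]
  noncomm_ring

variable (F U) in
/-- The trace of left multiplication. -/
noncomputable def leftTrace : U →ₗ[F] F := (LinearMap.trace F U).comp (LinearMap.mul F U)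

variable (F U) in
/-- The trace of right multiplication. -/
noncomputable def rightTrace : U →ₗ[F] F := (LinearMap.trace F U).comp (LinearMap.mul F U).flip

theorem leftTrace_apply (a : U) : leftTrace F U a = LinearMap.trace F U (LinearMap.mulLeft F a) :=
  rfl

theorem rightTrace_apply (a : U) :
    rightTrace F U a = LinearMap.trace F U (LinearMap.mulRight F a) := rfl

theorem leftTrace_mul_comm (a b : U) : leftTrace F U (a * b) = leftTrace F U (b * a) := by
  rw [leftTrace_apply, leftTrace_apply, LinearMap.mulLeft_mul, LinearMap.mulLeft_mul]
  exact LinearMap.trace_mul_comm F _ _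

/-- Left multiplication by `D a` is the commutator of `D` with left multiplication by `a`. -/
theorem leftTrace_derivation (D : U →ₗ[F] U) (hD : ∀ a b, D (a * b) = D a * b + a * D b) (a : U) :
    leftTrace F U (D a) = 0 := by
  have h : LinearMap.mulLeft F (D a) = D * LinearMap.mulLeft F a - LinearMap.mulLeft F a * D := by
    ext b
    simp [hD]
  rw [leftTrace_apply, h, map_sub, LinearMap.trace_mul_comm, sub_self]

variable [Module.Finite F U]

open Polynomial in
theorem _root_.Polynomial.exists_eq_X_pow_mul_and_isCoprime {F : Type*} [Field F] {p : F[X]}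
    (hp : p ≠ 0) : ∃ (n : ℕ) (q : F[X]), p = X ^ n * q ∧ IsCoprime (X ^ (n + 1)) q := by
  obtain ⟨q, hq, hqX⟩ := exists_eq_pow_rootMultiplicity_mul_and_not_dvd p hp 0
  rw [C_0, sub_zero] at hq hqX
  exact ⟨_, q, hq, ((irreducible_X.coprime_iff_not_dvd).2 hqX).pow_left⟩

open Polynomial in
-- A non-nilpotent `y` has a nonzero idempotent among its polynomial multiples, which `τ` would have
-- to kill.
theorem isNilpotent_of_functional (τ : U →ₗ[F] F)
    (hτ : ∀ e : U, IsIdempotentElem e → τ e = 0 → e = 0) {y : U} (h : ∀ z, τ (z * y) = 0) :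
    IsNilpotent y := by
  obtain ⟨n, q, hq, u, v, huv⟩ := Polynomial.exists_eq_X_pow_mul_and_isCoprime
    (minpoly.ne_zero (Algebra.IsIntegral.isIntegral (R := F) y))
  have hzero (r : F[X]) : aeval y (r * minpoly F y) = 0 := by
    rw [map_mul, minpoly.aeval, mul_zero]
  have hsum : aeval y (u * X ^ (n + 1)) + aeval y (v * q) = 1 := by
    rw [← map_add, huv, map_one]
  -- This is the Fitting idempotent of `y`. The exponent `n + 1` leaves a factor `y` even when `n =
  -- 0`.
  have he : aeval y (u * X ^ (n + 1)) = 0 := by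
    refine hτ _ ?_ ?_
    · have h0 : aeval y (u * X ^ (n + 1)) * aeval y (v * q) = 0 := by
        have h1 : u * X ^ (n + 1) * (v * q) = u * X * v * minpoly F y := by
          rw [hq]; ring
        rw [← map_mul, h1, hzero]
      rw [← eq_sub_iff_add_eq'] at hsum
      rw [hsum, mul_sub, mul_one, sub_eq_zero] at h0
      exact h0.symm
    · rw [pow_succ, ← mul_assoc, map_mul, aeval_X]
      exact h _
  rw [he, zero_add] at hsum
  have h1 : X ^ n * (v * q) = v * minpoly F y := by
    rw [hq]; ring
  refine ⟨n, ?_⟩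
  rw [← mul_one (y ^ n), ← hsum, ← hzero v, ← h1, map_mul (aeval y) (X ^ n), aeval_X_pow]

theorem isNilpotent_jacobson (F U : Type*) [Field F] [Ring U] [Algebra F U] [Module.Finite F U] :
    IsNilpotent (Ring.jacobson U) := by
  have := IsArtinianRing.of_finite F U
  rw [← Ideal.jacobson_bot]
  exact IsArtinianRing.isNilpotent_jacobson_bot

theorem isNilpotent_of_mem_jacobson (F : Type*) {U : Type*} [Field F] [Ring U] [Algebra F U]
    [Module.Finite F U] {a : U} (h : a ∈ Ring.jacobson U) : IsNilpotent a := by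
  obtain ⟨n, hn⟩ := isNilpotent_jacobson F U
  refine ⟨n, ?_⟩
  have := Ideal.pow_mem_pow h n
  rwa [hn] at this

variable [CharZero F]

theorem eq_zero_of_leftTrace_eq_zero {e : U} (he : IsIdempotentElem e)
    (h : leftTrace F U e = 0) : e = 0 := by
  have h1 : IsIdempotentElem (LinearMap.mulLeft F e) := by
    rw [IsIdempotentElem, Module.End.mul_eq_comp, ← LinearMap.mulLeft_mul, he.eq]
  have h2 := LinearMap.IsIdempotentElem.eq_zero_of_trace_eq_zero h1 h
  simpa using LinearMap.congr_fun h2 1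

theorem eq_zero_of_rightTrace_eq_zero {e : U} (he : IsIdempotentElem e)
    (h : rightTrace F U e = 0) : e = 0 := by
  have h1 : IsIdempotentElem (LinearMap.mulRight F e) := by
    rw [IsIdempotentElem, Module.End.mul_eq_comp, ← LinearMap.mulRight_mul, he.eq]
  have h2 := LinearMap.IsIdempotentElem.eq_zero_of_trace_eq_zero h1 h
  simpa using LinearMap.congr_fun h2 1

variable (F) in
/-- In characteristic zero the Jacobson radical is the radical of the trace form. -/
theorem mem_jacobson_iff_leftTrace {a : U} :
    a ∈ Ring.jacobson U ↔ ∀ x, leftTrace F U (x * a) = 0 := by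
  refine ⟨fun h x => ?_, fun h => mem_jacobson_of_forall_isNilpotent fun x => ?_⟩
  · obtain ⟨n, hn⟩ := isNilpotent_of_mem_jacobson F (Ideal.mul_mem_left _ x h)
    refine (LinearMap.isNilpotent_trace_of_isNilpotent ⟨n, ?_⟩).eq_zero
    change (LinearMap.mulLeft F (x * a)) ^ n = 0
    rw [LinearMap.pow_mulLeft, hn, LinearMap.mulLeft_zero_eq_zero]
  · refine isNilpotent_of_functional (leftTrace F U)
      (fun e he => eq_zero_of_leftTrace_eq_zero he) fun z => ?_
    rw [← mul_assoc]
    exact h _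

/-- In characteristic zero the Jacobson radical is stable under derivations. -/
theorem derivation_mem_jacobson (D : U →ₗ[F] U) (hD : ∀ a b, D (a * b) = D a * b + a * D b)
    {a : U} (ha : a ∈ Ring.jacobson U) : D a ∈ Ring.jacobson U := by
  rw [mem_jacobson_iff_leftTrace F] at ha ⊢
  intro x
  have h := leftTrace_derivation D hD (x * a)
  rwa [hD, map_add, ha, zero_add] at h

/-! ### Separability idempotents of semisimple algebras -/

variable (F) in
/-- A separability idempotent of a semisimple algebra that is killed by all derivations. -/
theorem exists_separabilityIdempotent (hU : Ring.jacobson U = ⊥) :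
    ∃ e : U ⊗[F] U, LinearMap.mul' F U e = 1 ∧
      (∀ a : U, (LinearMap.mulLeft F a).rTensor U e = (LinearMap.mulRight F a).lTensor U e) ∧
      ∀ D : U →ₗ[F] U, (∀ a b, D (a * b) = D a * b + a * D b) →
        D.rTensor U e + D.lTensor U e = 0 := by
  let B : LinearMap.BilinForm F U := (LinearMap.mul F U).compr₂ (leftTrace F U)
  have hBa (x y : U) : B x y = leftTrace F U (x * y) := rfl
  have hleft : ∀ x : U, (∀ y, B y x = 0) → x = 0 := by
    intro x hx
    have : x ∈ Ring.jacobson U := (mem_jacobson_iff_leftTrace F).2 hx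
    rwa [hU] at this
  have hB : B.Nondegenerate := by
    refine ⟨fun x hx => hleft x fun y => ?_, fun x hx => hleft x hx⟩
    rw [hBa, leftTrace_mul_comm]
    exact hx y
  obtain ⟨e, he, htr⟩ := B.exists_casimirTensor hB
  have heL (a : U) : (LinearMap.mulLeft F a).rTensor U e = (LinearMap.mulRight F a).lTensor U e := by
    refine he _ _ fun x y => ?_
    rw [hBa, hBa, LinearMap.mulLeft_apply, LinearMap.mulRight_apply, mul_assoc, leftTrace_mul_comm,
      mul_assoc]
  have heD (D : U →ₗ[F] U) (hD : ∀ a b, D (a * b) = D a * b + a * D b) :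
      D.rTensor U e + D.lTensor U e = 0 := by
    rw [he D (-D) fun a b => ?_, LinearMap.lTensor_neg, LinearMap.neg_apply, neg_add_cancel]
    have := leftTrace_derivation D hD (a * b)
    rw [hD, map_add] at this
    rw [hBa, hBa, LinearMap.neg_apply, mul_neg, map_neg]
    exact eq_neg_of_add_eq_zero_left this
  -- The value of `u` is not computed: it is enough that `u` is central, killed by derivations and
  -- invertible, since then dividing `e` by `u` normalises it.
  set u : U := LinearMap.mul' F U e with hu
  have mulL (a : U) (z : U ⊗[F] U) :
      LinearMap.mul' F U ((LinearMap.mulLeft F a).rTensor U z) = a * LinearMap.mul' F U z := by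
    induction z with
    | zero => simp
    | tmul x y => simp [mul_assoc]
    | add x y hx hy => rw [map_add, map_add, hx, hy, map_add, mul_add]
  have mulR (a : U) (z : U ⊗[F] U) :
      LinearMap.mul' F U ((LinearMap.mulRight F a).lTensor U z) = LinearMap.mul' F U z * a := by
    induction z with
    | zero => simp
    | tmul x y => simp [mul_assoc]
    | add x y hx hy => rw [map_add, map_add, hx, hy, map_add, add_mul]
  have hcent (a : U) : a * u = u * a := by rw [hu, ← mulL, heL, mulR]
  have hder (D : U →ₗ[F] U) (hD : ∀ a b, D (a * b) = D a * b + a * D b) : D u = 0 := by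
    have key (z : U ⊗[F] U) : LinearMap.mul' F U (D.rTensor U z + D.lTensor U z) =
        D (LinearMap.mul' F U z) := by
      induction z with
      | zero => simp
      | tmul x y => simp [hD]
      | add x y hx hy =>
        simp only [map_add] at hx hy ⊢
        rw [← hx, ← hy]
        abel
    rw [hu, ← key, heD D hD, map_zero]
  have htrace (c : U) : rightTrace F U c = leftTrace F U (u * c) := by
    rw [rightTrace_apply, ← htr]
    have key (z : U ⊗[F] U) : TensorProduct.lift (B.compl₂ (LinearMap.mulRight F c)) z =
        leftTrace F U (LinearMap.mul' F U z * c) := by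
      induction z with
      | zero => simp
      | tmul x y => simp [hBa, mul_assoc]
      | add x y hx hy => rw [map_add, hx, hy, map_add, add_mul, map_add]
    exact key e
  -- If `u * a = 0`, then by `htrace` the right trace vanishes on the two-sided products `z * (x *
  -- a)`, so each `x * a` is nilpotent and `a` is in the radical.
  have hinj : Function.Injective (LinearMap.mulLeft F u) := by
    rw [← LinearMap.ker_eq_bot, LinearMap.ker_eq_bot']
    intro a ha
    rw [LinearMap.mulLeft_apply] at ha
    have : a ∈ Ring.jacobson U := mem_jacobson_of_forall_isNilpotent fun x =>
      isNilpotent_of_functional (rightTrace F U) (fun e he => eq_zero_of_rightTrace_eq_zero he)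
        fun z => by
          rw [htrace, ← mul_assoc, ← hcent, mul_assoc, ← mul_assoc u, ← hcent, mul_assoc, ha,
            mul_zero, mul_zero, map_zero]
    rwa [hU] at this
  obtain ⟨v, hv⟩ := LinearMap.injective_iff_surjective.1 hinj 1
  rw [LinearMap.mulLeft_apply] at hv
  have hvu : v * u = 1 := by rw [hcent, hv]
  have hvc (a : U) : a * v = v * a := by
    apply hinj
    simp only [LinearMap.mulLeft_apply]
    rw [← mul_assoc, ← hcent, mul_assoc, hv, ← mul_assoc, hv, one_mul, mul_one]
  refine ⟨(LinearMap.mulLeft F v).rTensor U e, ?_, fun a => ?_, fun D hD => ?_⟩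
  · rw [mulL, ← hu, hvu]
  · rw [← LinearMap.comp_apply, ← LinearMap.rTensor_comp, ← LinearMap.mulLeft_mul, hvc,
      LinearMap.mulLeft_mul, LinearMap.rTensor_comp, LinearMap.comp_apply, heL,
      ← LinearMap.comp_apply, ← LinearMap.comp_apply, LinearMap.rTensor_comp_lTensor,
      LinearMap.lTensor_comp_rTensor]
  · have hDv : D v = 0 := by
      have h1 : D 1 = 0 := by simpa using hD 1 1
      have h2 := hD u v
      rw [hv, h1, hder D hD, zero_mul, zero_add] at h2
      apply hinj
      simp [← h2]
    have hDc : D.comp (LinearMap.mulLeft F v) = (LinearMap.mulLeft F v).comp D := by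
      ext x
      simp [hD, hDv]
    rw [← LinearMap.comp_apply, ← LinearMap.comp_apply, LinearMap.lTensor_comp_rTensor,
      ← LinearMap.rTensor_comp, hDc, LinearMap.rTensor_comp, ← LinearMap.rTensor_comp_lTensor,
      LinearMap.comp_apply, LinearMap.comp_apply, ← map_add, heD D hD, map_zero]

/-! ### Wedderburn's principal theorem by successive correction of a section -/

section

variable {F U S : Type*} [Field F] [Ring U] [Algebra F U] [Ring S] [Algebra F S]

/-- The failure of a linear map between algebras to be multiplicative. -/
noncomputable def mulDefect (s : S →ₗ[F] U) : S →ₗ[F] S →ₗ[F] U :=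
  (LinearMap.mul F U).compl₁₂ s s - (LinearMap.mul F S).compr₂ s

theorem mulDefect_apply (s : S →ₗ[F] U) (a b : S) : mulDefect s a b = s a * s b - s (a * b) := rfl

/-- Associativity of `s x * s a * s b`, in the form of a Hochschild 2-cocycle identity. -/
theorem mulDefect_cocycle (s : S →ₗ[F] U) (x a b : S) :
    mulDefect s (x * a) b = s x * mulDefect s a b + mulDefect s x (a * b) -
      mulDefect s x a * s b := by
  simp only [mulDefect_apply, mul_assoc, mul_sub, sub_mul]
  abel

theorem mulDefect_derivation {s : S →ₗ[F] U} {D : U →ₗ[F] U} {D' : S →ₗ[F] S}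
    (hD : ∀ a b, D (a * b) = D a * b + a * D b) (hD' : ∀ a b, D' (a * b) = D' a * b + a * D' b)
    (h : ∀ a, D (s a) = s (D' a)) (a b : S) :
    D (mulDefect s a b) = mulDefect s (D' a) b + mulDefect s a (D' b) := by
  simp only [mulDefect_apply, map_sub, hD, hD', h, map_add]
  abel

/-- Contraction of the multiplicativity defect with a tensor. -/
noncomputable def contractDefect (s : S →ₗ[F] U) (e : S ⊗[F] S) : S →ₗ[F] U where
  toFun a := TensorProduct.lift ((LinearMap.mul F U).compl₁₂ s ((mulDefect s).flip a)) e
  map_add' a b := by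
    have : TensorProduct.lift ((LinearMap.mul F U).compl₁₂ s ((mulDefect s).flip (a + b))) =
        TensorProduct.lift ((LinearMap.mul F U).compl₁₂ s ((mulDefect s).flip a)) +
          TensorProduct.lift ((LinearMap.mul F U).compl₁₂ s ((mulDefect s).flip b)) :=
      TensorProduct.ext' fun x y => by simp [mul_add]
    exact LinearMap.congr_fun this e
  map_smul' r a := by
    have : TensorProduct.lift ((LinearMap.mul F U).compl₁₂ s ((mulDefect s).flip (r • a))) =
        r • TensorProduct.lift ((LinearMap.mul F U).compl₁₂ s ((mulDefect s).flip a)) :=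
      TensorProduct.ext' fun x y => by simp
    exact LinearMap.congr_fun this e

@[simp]
theorem contractDefect_zero (s : S →ₗ[F] U) (a : S) : contractDefect s 0 a = 0 :=
  (TensorProduct.lift ((LinearMap.mul F U).compl₁₂ s ((mulDefect s).flip a))).map_zero

@[simp]
theorem contractDefect_add (s : S →ₗ[F] U) (e e' : S ⊗[F] S) (a : S) :
    contractDefect s (e + e') a = contractDefect s e a + contractDefect s e' a :=
  (TensorProduct.lift ((LinearMap.mul F U).compl₁₂ s ((mulDefect s).flip a))).map_add _ _

@[simp]
theorem contractDefect_tmul (s : S →ₗ[F] U) (x y a : S) :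
    contractDefect s (x ⊗ₜ y) a = s x * mulDefect s y a := rfl

theorem contractDefect_mem {s : S →ₗ[F] U} {I : Ideal U} (h : ∀ a b, mulDefect s a b ∈ I)
    (e : S ⊗[F] S) (a : S) : contractDefect s e a ∈ I :=
  TensorProduct.lift_mem _ I (fun _ _ => I.mul_mem_left _ (h _ _)) e

theorem contractDefect_derivation {s : S →ₗ[F] U} {D : U →ₗ[F] U} {D' : S →ₗ[F] S}
    (hD : ∀ a b, D (a * b) = D a * b + a * D b) (hD' : ∀ a b, D' (a * b) = D' a * b + a * D' b)
    (h : ∀ a, D (s a) = s (D' a)) (e : S ⊗[F] S) (a : S) :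
    D (contractDefect s e a) =
      contractDefect s (D'.rTensor S e + D'.lTensor S e) a + contractDefect s e (D' a) := by
  induction e with
  | zero => simp
  | tmul x y => simp [hD, h, mulDefect_derivation hD hD' h, mul_add, add_assoc]
  | add x y hx hy =>
    simp only [map_add, contractDefect_add] at hx hy ⊢
    rw [hx, hy]
    abel

/-- On pure tensors the error is the product of defects `mulDefect s a x * mulDefect s y b`. -/
theorem mul_contractDefect_sub_mem {s : S →ₗ[F] U} {I J : Ideal U} (hIJ : I ≤ J)
    (h : ∀ a b, mulDefect s a b ∈ I) (e : S ⊗[F] S) (a b : S) :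
    s a * contractDefect s e b - contractDefect s ((LinearMap.mulLeft F a).rTensor S e) b ∈
      J * I := by
  induction e with
  | zero => simp
  | tmul x y =>
    have : s a * contractDefect s (x ⊗ₜ[F] y) b -
        contractDefect s ((LinearMap.mulLeft F a).rTensor S (x ⊗ₜ[F] y)) b =
        mulDefect s a x * mulDefect s y b := by
      rw [LinearMap.rTensor_tmul, contractDefect_tmul, contractDefect_tmul,
        LinearMap.mulLeft_apply, mulDefect_apply s a x, sub_mul, mul_assoc]
    rw [this]
    exact Ideal.mul_mem_mul (hIJ (h _ _)) (h _ _)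
  | add x y hx hy =>
    rw [map_add, contractDefect_add, contractDefect_add, mul_add, add_sub_add_comm]
    exact add_mem hx hy

/-- Expand `mulDefect s (y * a) b` by the cocycle identity; replacing `s x * s y` by `s (x * y)`
costs a product of two defects. -/
theorem contractDefect_lTensor_sub_mem {s : S →ₗ[F] U} {I J : Ideal U} (hIJ : I ≤ J)
    (h : ∀ a b, mulDefect s a b ∈ I) (e : S ⊗[F] S) (a b : S) :
    contractDefect s ((LinearMap.mulRight F a).lTensor S e) b -
      (s (LinearMap.mul' F S e) * mulDefect s a b + contractDefect s e (a * b) -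
        contractDefect s e a * s b) ∈ J * I := by
  induction e with
  | zero => simp
  | tmul x y =>
    have : contractDefect s ((LinearMap.mulRight F a).lTensor S (x ⊗ₜ[F] y)) b -
        (s (LinearMap.mul' F S (x ⊗ₜ[F] y)) * mulDefect s a b +
          contractDefect s (x ⊗ₜ[F] y) (a * b) - contractDefect s (x ⊗ₜ[F] y) a * s b) =
        mulDefect s x y * mulDefect s a b := by
      rw [LinearMap.lTensor_tmul, contractDefect_tmul, contractDefect_tmul, contractDefect_tmul,
        LinearMap.mulRight_apply, LinearMap.mul'_apply, mulDefect_cocycle, mulDefect_apply s x y]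
      noncomm_ring
    rw [this]
    exact Ideal.mul_mem_mul (hIJ (h _ _)) (h _ _)
  | add x y hx hy =>
    convert add_mem hx hy using 1
    simp only [map_add, contractDefect_add, add_mul]
    abel

/-- Correcting a section by the contraction of its defect with a separability idempotent. -/
theorem mulDefect_sub_contractDefect_mem {s : S →ₗ[F] U} {I J : Ideal U} (hIJ : I ≤ J)
    (h : ∀ a b, mulDefect s a b ∈ I) (h1 : s 1 - 1 ∈ J) {e : S ⊗[F] S}
    (he1 : LinearMap.mul' F S e = 1)
    (he : ∀ a : S, (LinearMap.mulLeft F a).rTensor S e = (LinearMap.mulRight F a).lTensor S e)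
    (a b : S) : mulDefect (s - contractDefect s e) a b ∈ J * I := by
  -- Let `h` be the contraction. Since `e` intertwines the two multiplications by `a`, `m1` and `m2`
  -- give `s a * h b - h (a * b) + h a * s b ≡ s 1 * mulDefect s a b`: the defect is the coboundary
  -- of `h`, up to the errors `m3` (`s 1 ≠ 1`) and `m4` (the quadratic term).
  have m1 := mul_contractDefect_sub_mem hIJ h e a b
  have m2 := contractDefect_lTensor_sub_mem hIJ h e a b
  have m3 : (s 1 - 1) * mulDefect s a b ∈ J * I := Ideal.mul_mem_mul h1 (h a b)
  have m4 : contractDefect s e a * contractDefect s e b ∈ J * I :=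
    Ideal.mul_mem_mul (hIJ (contractDefect_mem h e a)) (contractDefect_mem h e b)
  rw [he1] at m2
  rw [he] at m1
  convert sub_mem m4 (add_mem (add_mem m1 m2) m3) using 1
  simp only [mulDefect_apply, LinearMap.sub_apply]
  noncomm_ring

/-- **Wedderburn's principal theorem**, equivariantly: a linear section that commutes with a set
of derivations may be improved to a multiplicative one. -/
theorem exists_multiplicative_section [CharZero F] [Module.Finite F S] (hS : Ring.jacobson S = ⊥)
    (π : U →ₐ[F] S) (hπ : IsNilpotent (RingHom.ker π)) (s : S →ₗ[F] U) (hs : ∀ a, π (s a) = a)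
    (𝒟 : Set ((U →ₗ[F] U) × (S →ₗ[F] S)))
    (h𝒟 : ∀ D ∈ 𝒟, ∀ a b, D.1 (a * b) = D.1 a * b + a * D.1 b)
    (h𝒟' : ∀ D ∈ 𝒟, ∀ a b, D.2 (a * b) = D.2 a * b + a * D.2 b)
    (h𝒟s : ∀ D ∈ 𝒟, ∀ a, D.1 (s a) = s (D.2 a)) :
    ∃ s : S →ₗ[F] U, (∀ a, π (s a) = a) ∧ (∀ D ∈ 𝒟, ∀ a, D.1 (s a) = s (D.2 a)) ∧
      ∀ a b, s (a * b) = s a * s b := by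
  obtain ⟨e, he1, he, heD⟩ := exists_separabilityIdempotent F hS
  set J := RingHom.ker π with hJ
  have key (k : ℕ) : ∃ s : S →ₗ[F] U, (∀ a, π (s a) = a) ∧
      (∀ D ∈ 𝒟, ∀ a, D.1 (s a) = s (D.2 a)) ∧ ∀ a b, mulDefect s a b ∈ J ^ (k + 1) := by
    induction k with
    | zero =>
      refine ⟨s, hs, h𝒟s, fun a b => ?_⟩
      rw [zero_add, Submodule.pow_one, hJ, RingHom.mem_ker, mulDefect_apply, map_sub, map_mul, hs, hs, hs,
        sub_self]
    | succ k ih =>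
      obtain ⟨s, hs, hsD, hf⟩ := ih
      have hle : J ^ (k + 1) ≤ J := Ideal.pow_le_self k.succ_ne_zero
      refine ⟨s - contractDefect s e, fun a => ?_, fun D hD a => ?_, fun a b => ?_⟩
      · have : π (contractDefect s e a) = 0 := hle (contractDefect_mem hf e a)
        rw [LinearMap.sub_apply, map_sub, hs, this, sub_zero]
      · rw [LinearMap.sub_apply, map_sub, LinearMap.sub_apply, hsD D hD,
          contractDefect_derivation (h𝒟 D hD) (h𝒟' D hD) (hsD D hD), heD D.2 (h𝒟' D hD),
          contractDefect_zero, zero_add]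
      · rw [Ideal.IsTwoSided.pow_succ]
        refine mulDefect_sub_contractDefect_mem hle hf ?_ he1 he a b
        rw [hJ, RingHom.mem_ker, map_sub, hs, map_one, sub_self]
  obtain ⟨n, hn⟩ := hπ
  obtain ⟨s, hs, hsD, hf⟩ := key n
  refine ⟨s, hs, hsD, fun a b => ?_⟩
  have := Ideal.pow_le_pow_right n.le_succ (hf a b)
  rw [hn, Ideal.zero_eq_bot, Submodule.mem_bot, mulDefect_apply, sub_eq_zero] at this
  exact this.symm

end

/-- An equivariant Wedderburn decomposition of a unital algebra, relative to a set of derivations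
that commute with a linear projection along the Jacobson radical. -/
theorem exists_stable_complement_jacobson {F U : Type*} [Field F] [CharZero F] [Ring U]
    [Algebra F U] [Module.Finite F U] (𝒟 : Set (U →ₗ[F] U))
    (h𝒟 : ∀ D ∈ 𝒟, ∀ a b, D (a * b) = D a * b + a * D b) (P : U →ₗ[F] U)
    (hP : ∀ a, P a - a ∈ Ring.jacobson U) (hPJ : ∀ a ∈ Ring.jacobson U, P a = 0)
    (hP𝒟 : ∀ D ∈ 𝒟, ∀ a, D (P a) = P (D a)) :
    ∃ B : NonUnitalSubalgebra F U, (∀ b ∈ B, b ∈ Ring.jacobson U → b = 0) ∧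
      (∀ a, ∃ b ∈ B, a - b ∈ Ring.jacobson U) ∧ ∀ D ∈ 𝒟, ∀ b ∈ B, D b ∈ B := by
  set J := Ring.jacobson U
  let π : U →ₐ[F] U ⧸ J := Ideal.Quotient.mkₐ F J
  have hπ0 (a : U) : π a = 0 ↔ a ∈ J := Ideal.Quotient.eq_zero_iff_mem
  have hπs : Function.Surjective π := Ideal.Quotient.mk_surjective
  have hker : RingHom.ker π = J := Ideal.ext hπ0
  have hfin : Module.Finite F (U ⧸ J) := Module.Finite.of_surjective π.toLinearMap hπs
  obtain ⟨σ, hσ⟩ := π.toLinearMap.exists_rightInverse_of_surjective (LinearMap.range_eq_top.2 hπs)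
  replace hσ (c : U ⧸ J) : π (σ c) = c := LinearMap.congr_fun hσ c
  have hπP (a : U) : π (P a) = π a := by
    rw [← sub_eq_zero, ← map_sub, hπ0]
    exact hP a
  have hPπ (a b : U) (h : π a = π b) : P a = P b := by
    rw [← sub_eq_zero, ← map_sub] at h ⊢
    exact hPJ _ ((hπ0 _).1 h)
  -- The second component is the derivation induced by `D` on the quotient: `P` kills `J` and
  -- commutes with `D`, so the choice of lift `σ` is immaterial.
  let 𝒟' : Set ((U →ₗ[F] U) × (U ⧸ J →ₗ[F] U ⧸ J)) :=
    (fun D => (D, π.toLinearMap ∘ₗ D ∘ₗ P ∘ₗ σ)) '' 𝒟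
  obtain ⟨s, hs, hsD, hmul⟩ := exists_multiplicative_section (Ring.jacobson_quotient_jacobson U)
    π (by rw [hker]; exact isNilpotent_jacobson F U) (P ∘ₗ σ) (fun a => by simp [hπP, hσ]) 𝒟'
    (by rintro _ ⟨D, hD, rfl⟩; exact h𝒟 D hD)
    (by
      rintro _ ⟨D, hD, rfl⟩ a b
      have key (u : U) : π (D (P (σ (π u)))) = π (D u) := by
        rw [hPπ _ u (hσ _), hP𝒟 D hD, hπP]
      obtain ⟨a, rfl⟩ := hπs a
      obtain ⟨b, rfl⟩ := hπs b
      simp only [LinearMap.comp_apply, AlgHom.toLinearMap_apply]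
      rw [← map_mul, key, key, key, h𝒟 D hD, map_add, map_mul, map_mul])
    (by
      rintro _ ⟨D, hD, rfl⟩ a
      simp only [LinearMap.comp_apply, AlgHom.toLinearMap_apply]
      rw [hPπ (σ (π _)) _ (hσ _), ← hP𝒟 D hD, hPπ (P (σ a)) (σ a) (hπP _)])
  let B : NonUnitalSubalgebra F U :=
    { LinearMap.range s with
      mul_mem' := by
        rintro _ _ ⟨a, rfl⟩ ⟨b, rfl⟩
        exact ⟨a * b, hmul a b⟩ }
  refine ⟨B, ?_, fun a => ⟨s (π a), ⟨π a, rfl⟩, ?_⟩, ?_⟩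
  · rintro _ ⟨c, rfl⟩ hc
    rw [← hπ0, hs] at hc
    rw [hc, map_zero]
  · rw [← hπ0, map_sub, hs, sub_self]
  · rintro D hD _ ⟨c, rfl⟩
    exact ⟨_, (hsD _ ⟨D, hD, rfl⟩ c).symm⟩

end FiniteDimensionalAlgebra

/-! ### Radicals of nonunital algebras through the unitization; maximality -/

namespace AssocAlg

section

variable (F : Type*) {A : Type*} [Field F] [NonUnitalRing A] [Module F A]
  [IsScalarTower F A A] [SMulCommClass F A A]

theorem mem_jacobsonRadical {a : A} :
    a ∈ jacobsonRadical F A ↔ (a : Unitization F A) ∈ Ring.jacobson (Unitization F A) :=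
  forall_isQuasiregular_mul_iff F a

theorem finite_unitization [Module.Finite F A] : Module.Finite F (Unitization F A) :=
  Module.Finite.of_surjective
    ((Algebra.linearMap F (Unitization F A)).coprod (Unitization.inrHom F F A))
    fun u => ⟨(u.fst, u.snd), Unitization.inl_fst_add_inr_snd_eq u⟩

theorem mem_jacobsonRadical_iff_isNilpotent [Module.Finite F A] {a : A} :
    a ∈ jacobsonRadical F A ↔ ∀ x : A, IsNilpotent ((x * a : A) : Unitization F A) := by
  have := finite_unitization F (A := A)
  refine ⟨fun h x => ?_, fun h x => ?_⟩
  · rw [Unitization.inr_mul]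
    exact FiniteDimensionalAlgebra.isNilpotent_of_mem_jacobson F
      (Ideal.mul_mem_left _ _ ((mem_jacobsonRadical F).1 h))
  · rw [isQuasiregular_iff_isUnit' F]
    exact (h x).isUnit_one_add

variable {F}

/-- Elements of the radical are nilpotent, so their scalar component in the field `F` is zero. -/
theorem exists_eq_inr_of_mem_jacobson [Module.Finite F A] {u : Unitization F A}
    (hu : u ∈ Ring.jacobson (Unitization F A)) :
    ∃ a ∈ jacobsonRadical F A, u = (a : Unitization F A) := by
  have := finite_unitization F (A := A)
  have h := (FiniteDimensionalAlgebra.isNilpotent_of_mem_jacobson F hu).map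
    (Unitization.fstHom F A)
  have h0 : u.fst = 0 := h.eq_zero
  have h1 : u = (u.snd : Unitization F A) := by
    ext <;> simp [h0]
  exact ⟨u.snd, (mem_jacobsonRadical F).2 (h1 ▸ hu), h1⟩

/-- The unitization of `C` embeds in that of `A`. With the nilpotency criterion for the radical,
this allows `J(C)` and `J(A)` to be compared. -/
theorem isNilpotent_inr_subalgebra_iff (C : NonUnitalSubalgebra F A) (c : C) :
    IsNilpotent (c : Unitization F C) ↔ IsNilpotent ((c : A) : Unitization F A) := by
  let ψ : Unitization F C →ₐ[F] Unitization F A :=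
    Unitization.lift ((Unitization.inrNonUnitalAlgHom F A).comp
      (NonUnitalSubalgebraClass.subtype C))
  have hψ (u : Unitization F C) : ψ u = Unitization.inl u.fst + ((u.snd : A) : Unitization F A) :=
    rfl
  have hinj : Function.Injective ψ := by
    intro u v h
    rw [hψ, hψ] at h
    have h1 := congrArg (fun w : Unitization F A => w.fst) h
    have h2 := congrArg (fun w : Unitization F A => w.snd) h
    ext
    · simpa using h1
    · simpa using h2
  have hc : ψ c = ((c : A) : Unitization F A) := by simp [hψ]
  rw [← hc, IsNilpotent.map_iff hinj]

variable [Module.Finite F A]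

/-- A subalgebra complementary to the Jacobson radical is semisimple. -/
theorem isSemisimpleAlg_of_isCompl {B : NonUnitalSubalgebra F A}
    (h : IsCompl B.toSubmodule (jacobsonRadical F A)) : IsSemisimpleAlg F B := by
  have := finite_unitization F (A := A)
  rw [IsSemisimpleAlg, eq_bot_iff]
  intro b hb
  have hfinB : Module.Finite F B := inferInstanceAs (Module.Finite F B.toSubmodule)
  rw [mem_jacobsonRadical_iff_isNilpotent] at hb
  -- Modulo the radical, `(y + j) * b` equals the nilpotent `y * b`; some power thus lies in the
  -- radical, which is nil.
  have hbJ : (b : A) ∈ jacobsonRadical F A := by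
    rw [mem_jacobsonRadical_iff_isNilpotent]
    intro x
    have hx : x ∈ B.toSubmodule ⊔ jacobsonRadical F A := by rw [h.sup_eq_top]; trivial
    obtain ⟨y, hy, j, hj, rfl⟩ := Submodule.mem_sup.1 hx
    obtain ⟨n, hn⟩ := (isNilpotent_inr_subalgebra_iff B _).1 (hb ⟨y, hy⟩)
    let q := Ideal.Quotient.mk (Ring.jacobson (Unitization F A))
    have hq : q (((y + j) * (b : A) : A) : Unitization F A) =
        q ((y * (b : A) : A) : Unitization F A) := by
      rw [add_mul, Unitization.inr_add, map_add, Unitization.inr_mul _ j, map_mul q (j : Unitization F A),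
        Ideal.Quotient.eq_zero_iff_mem.2 ((mem_jacobsonRadical F).1 hj), zero_mul, add_zero]
    have hpow : (((y + j) * (b : A) : A) : Unitization F A) ^ n ∈
        Ring.jacobson (Unitization F A) := by
      rw [← Ideal.Quotient.eq_zero_iff_mem, map_pow]
      change q _ ^ n = 0
      rw [hq, ← map_pow]
      exact (congrArg q hn).trans (map_zero q)
    obtain ⟨m, hm⟩ := FiniteDimensionalAlgebra.isNilpotent_of_mem_jacobson F hpow
    exact ⟨n * m, by rw [pow_mul, hm]⟩
  have := Submodule.disjoint_def.1 h.disjoint b b.2 hbJ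
  exact Subtype.ext this

/-- A subalgebra complementary to the Jacobson radical is a maximal semisimple subalgebra. -/
theorem maximal_isSemisimpleAlg_of_isCompl {B : NonUnitalSubalgebra F A}
    (h : IsCompl B.toSubmodule (jacobsonRadical F A)) :
    Maximal (fun C : NonUnitalSubalgebra F A => IsSemisimpleAlg F C) B := by
  refine ⟨isSemisimpleAlg_of_isCompl h, fun C hC hBC c hc => ?_⟩
  have hx : c ∈ B.toSubmodule ⊔ jacobsonRadical F A := by rw [h.sup_eq_top]; trivial
  obtain ⟨b, hb, j, hj, rfl⟩ := Submodule.mem_sup.1 hx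
  -- As `B ≤ C`, the radical part `j` of `c` stays in `C`, and its left multiples there are
  -- nilpotent, so it lies in `J(C) = 0`.
  have hjC : j ∈ C := by
    have := sub_mem hc (hBC hb)
    rwa [add_sub_cancel_left] at this
  have hfinC : Module.Finite F C := inferInstanceAs (Module.Finite F C.toSubmodule)
  have hjJ : (⟨j, hjC⟩ : C) ∈ jacobsonRadical F C := by
    rw [mem_jacobsonRadical_iff_isNilpotent]
    intro x
    rw [isNilpotent_inr_subalgebra_iff]
    exact (mem_jacobsonRadical_iff_isNilpotent F).1 hj x
  change IsSemisimpleAlg F C at hC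
  rw [hC, Submodule.mem_bot] at hjJ
  have hj0 : j = 0 := congrArg Subtype.val hjJ
  rw [hj0, add_zero]
  exact hb

end

/-! ### The Lie action on the unitization -/

section

variable {F g A : Type*} [Field F] [NonUnitalRing A] [Module F A] [LieRing g] [LieAlgebra F g]
  [LieRingModule g A] [LieModule F g A]

variable (F A) in
/-- The action of an element of a Lie algebra on the algebra with an identity adjoined. -/
noncomputable def unitizationAction (x : g) : Unitization F A →ₗ[F] Unitization F A :=
  Unitization.inrHom F F A ∘ₗ LieModule.toEnd F g A x ∘ₗ Unitization.sndHom F F A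

theorem unitizationAction_apply (x : g) (u : Unitization F A) :
    unitizationAction F A x u = (⁅x, u.snd⁆ : A) := rfl

theorem ActsByDerivations.unitizationAction_mul (h : ActsByDerivations g A) (x : g)
    (u v : Unitization F A) : unitizationAction F A x (u * v) =
      unitizationAction F A x u * v + u * unitizationAction F A x v := by
  simp only [unitizationAction_apply]
  ext
  · simp
  · simp only [Unitization.snd_mul, Unitization.snd_add, Unitization.snd_inr, Unitization.fst_inr,
      lie_add, lie_smul, h x, zero_smul, zero_add, add_zero]
    abel

variable [IsScalarTower F A A] [SMulCommClass F A A]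

/-- The Jacobson radical as a Lie submodule. -/
def jacobsonLieSubmodule [CharZero F] [Module.Finite F A] (h : ActsByDerivations g A) :
    LieSubmodule F g A where
  __ := jacobsonRadical F A
  lie_mem {x a} ha := by
    have := finite_unitization F (A := A)
    exact (mem_jacobsonRadical F).2 (FiniteDimensionalAlgebra.derivation_mem_jacobson
      (unitizationAction F A x) (h.unitizationAction_mul x) ((mem_jacobsonRadical F).1 ha))

end

end AssocAlg

theorem mainTheorem5 {F g A : Type*} [Field F] [IsAlgClosed F] [CharZero F]
    [NonUnitalRing A] [Module F A] [IsScalarTower F A A] [SMulCommClass F A A]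
    [Module.Finite F A]
    [LieRing g] [LieAlgebra F g] [Module.Finite F g] [LieAlgebra.HasTrivialRadical F g]
    [LieRingModule g A] [LieModule F g A]
    (hder : AssocAlg.ActsByDerivations g A) :
    ∃ B : NonUnitalSubalgebra F A,
      Maximal (fun C : NonUnitalSubalgebra F A => AssocAlg.IsSemisimpleAlg F C) B ∧
      ∃ M N : LieSubmodule F g A,
        M.toSubmodule = B.toSubmodule ∧
        N.toSubmodule = AssocAlg.jacobsonRadical F A ∧
        IsCompl M.toSubmodule N.toSubmodule := by
  have := AssocAlg.finite_unitization F (A := A)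
  let N : LieSubmodule F g A := AssocAlg.jacobsonLieSubmodule hder
  obtain ⟨p, hpg, hpN, hp⟩ := LieAlgebra.exists_equivariant_projection N
  -- The equivariant projection of the unitization along its radical; it fixes the identity.
  let P : Unitization F A →ₗ[F] Unitization F A :=
    LinearMap.id - Unitization.inrHom F F A ∘ₗ p ∘ₗ Unitization.sndHom F F A
  have hP (u : Unitization F A) : P u = u - (p u.snd : A) := rfl
  obtain ⟨B, hBJ, hB, hBg⟩ := FiniteDimensionalAlgebra.exists_stable_complement_jacobson
    (Set.range (AssocAlg.unitizationAction F A : g → _))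
    (by rintro _ ⟨x, rfl⟩; exact hder.unitizationAction_mul x) P
    (fun u => by
      rw [hP, sub_sub_cancel_left]
      exact neg_mem ((AssocAlg.mem_jacobsonRadical F).1 (hpN _)))
    (fun u hu => by
      obtain ⟨a, ha, rfl⟩ := AssocAlg.exists_eq_inr_of_mem_jacobson hu
      rw [hP, Unitization.snd_inr, hp a ha, sub_self])
    (by
      rintro _ ⟨x, rfl⟩ u
      rw [hP, hP, map_sub]
      simp only [AssocAlg.unitizationAction_apply, Unitization.snd_inr, hpg])
  let B' : NonUnitalSubalgebra F A := B.comap (Unitization.inrNonUnitalAlgHom F A)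
  have hB' (a : A) : a ∈ B' ↔ (a : Unitization F A) ∈ B := Iff.rfl
  have hcompl : IsCompl B'.toSubmodule (AssocAlg.jacobsonRadical F A) := by
    constructor
    · rw [Submodule.disjoint_def]
      intro a ha haJ
      exact Unitization.inr_injective (R := F)
        ((hBJ _ ha ((AssocAlg.mem_jacobsonRadical F).1 haJ)).trans (Unitization.inr_zero F).symm)
    · rw [codisjoint_iff, eq_top_iff]
      intro a _
      obtain ⟨b, hb, hab⟩ := hB a
      obtain ⟨j, hj, hjb⟩ := AssocAlg.exists_eq_inr_of_mem_jacobson hab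
      -- The radical of the unitization lies in `A`, so the `B`-component of an element of `A` is
      -- again in `A`.
      refine Submodule.mem_sup.2 ⟨a - j, ?_, j, hj, sub_add_cancel _ _⟩
      change ((a - j : A) : Unitization F A) ∈ B
      rwa [Unitization.inr_sub, ← hjb, sub_sub_cancel]
  refine ⟨B', AssocAlg.maximal_isSemisimpleAlg_of_isCompl hcompl,
    { B'.toSubmodule with lie_mem := fun {x a} ha => hBg _ ⟨x, rfl⟩ _ ha }, N, rfl, rfl, hcompl⟩
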